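/- Let $(\nu,\lambda)$ be admissible, i.e. $0<\nu<1$ and $2\sqrt{\nu}\le\lambda<1+\nu$. Put $$H(x,y)=\lambda^2+2\nu(1-x^2)y\lambda+2x(1-\nu^2y^2)\lambda-\nu^2+\nu(1-\lambda^2-\nu^2)x^2y^2+1,$$ $$y_c=-\frac{\lambda+\sqrt{\lambda^2-4\nu}}{2\nu},\qquad x_*=-\frac{2\lambda\nu}{\lambda^2+\nu^2-1}\quad(\text{if }\lambda^2+\nu^2\neq1),$$ and let $\mathrm{Sing}=\{(x,y)\in[-1,1]\times\mathbb R: H(x,y)=0\}$. Then $$\mathrm{Sing}\cap\{y\notin(-1,1)\}=\gamma_+\cup\gamma_-,$$ where $\gamma_\pm$ are two connected differentiable curves (images of regular $C^\infty$ embeddings of nondegenerate intervals), with $\gamma_-\subset R_-:=[-1,1]\times(-\infty,y_c)$ and $\gamma_+\subset R_+:=[-1,1]\times(1,\infty)$, such that each of $R_-\setminus\gamma_-$ and $R_+\setminus\gamma_+$ has exactly two connected components. Moreover: 1. If $\lambda+\nu<1$, each of $\gamma_\pm$ has positive distance from the lines $x=1$ and $x=-1$, and is an embedded copy of $\mathbb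 R$ along one end of which $x\to0$ and along the other end of which $x\to x_*$; at both ends $y\to+\infty$ for $\gamma_+$ and $y\to-\infty$ for $\gamma_-$. 2. If $\lambda+\nu>1$, each of $\gamma_\pm$ meets the line $x=1$ in exactly one point, has positive distance from the line $x=-1$, and is an embedded copy of a closed half-line along whose infinite end $x\to0$, with $y\to+\infty$ for $\gamma_+$ and $y\to-\infty$ for $\gamma_-$. 3. If $\lambda+\nu=1$, each of $\gamma_\pm$ has positive distance from the line $x=-1$, does not meet the line $x=1$, and is an embedded copy of $\mathbb R$ along one end of which $x\to0$ and along the other end of which $x\to1$; at both ends $y\to+\infty$ for $\gamma_+$ and $y\to-\infty$ for $\gamma_-$. -/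

import Mathlib

open Set Filter Topology
open scoped ContDiff

namespace PomeranskySenkov

noncomputable section

/-- Admissible parameters: `0 < ν < 1` and `2 √ν ≤ λ < 1 + ν` (here `l` stands for `λ`). -/
def Admissible (ν l : ℝ) : Prop :=
  0 < ν ∧ ν < 1 ∧ 2 * √ν ≤ l ∧ l < 1 + ν

/-- The polynomial `H(x,y)` of the Pomeransky–Senkov metric. -/
def H (ν l x y : ℝ) : ℝ :=
  l ^ 2 + 2 * ν * (1 - x ^ 2) * y * l + 2 * x * (1 - ν ^ 2 * y ^ 2) * l - ν ^ 2
    + ν * (-l ^ 2 - ν ^ 2 + 1) * x ^ 2 * y ^ 2 + 1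

/-- The smaller root `y_c` of `ν y² + λ y + 1`. -/
def yc (ν l : ℝ) : ℝ := -(l + √(l ^ 2 - 4 * ν)) / (2 * ν)

/-- The abscissa `x_*`; it is used only when `λ + ν < 1`, where the denominator is negative. -/
def xStar (ν l : ℝ) : ℝ := -(2 * l * ν) / (l ^ 2 + ν ^ 2 - 1)

/-- The singular set: the zeros of `H` with `x ∈ [-1,1]`. -/
def Sing (ν l : ℝ) : Set (ℝ × ℝ) := {p | p.1 ∈ Icc (-1) 1 ∧ H ν l p.1 p.2 = 0}

/-- The region `{y < y_c}` of the strip `x ∈ [-1,1]`. -/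
def lowerRegion (ν l : ℝ) : Set (ℝ × ℝ) := Icc (-1) 1 ×ˢ Iio (yc ν l)

/-- The region `{y > 1}` of the strip `x ∈ [-1,1]`. -/
def upperRegion : Set (ℝ × ℝ) := Icc (-1) 1 ×ˢ Ioi 1

/-- `c`, restricted to `I`, is a smooth regular parametrization of `γ` that is a homeomorphism
of `I` onto `γ`. -/
structure IsCurveParam (I : Set ℝ) (c : ℝ → ℝ × ℝ) (γ : Set (ℝ × ℝ)) : Prop where
  contDiffOn : ContDiffOn ℝ ∞ c I
  regular : ∀ t ∈ I, derivWithin c I t ≠ 0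
  isEmbedding : IsEmbedding (fun t : I => c t)
  image_eq : c '' I = γ

/-- Connected differentiable curves: smoothly embedded nondegenerate intervals. -/
def IsConnectedCurve (γ : Set (ℝ × ℝ)) : Prop :=
  ∃ (I : Set ℝ) (c : ℝ → ℝ × ℝ), I.OrdConnected ∧ I.Nontrivial ∧ IsCurveParam I c γ

/-- `γ` is a smoothly embedded line: along one end `x → a`, along the other end `x → b`, and `y`
tends to infinity along `l` (`l = atBot` or `l = atTop`) at both ends. -/
def AsymptotesToTwoLines (γ : Set (ℝ × ℝ)) (a b : ℝ) (l : Filter ℝ) : Prop :=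
  ∃ c : ℝ → ℝ × ℝ, IsCurveParam univ c γ ∧
    Tendsto c atBot (𝓝 a ×ˢ l) ∧ Tendsto c atTop (𝓝 b ×ˢ l)

/-- `γ` is a smoothly embedded closed half-line: along its only end `x → a`, while `y` tends to
infinity along `l` (`l = atBot` or `l = atTop`). -/
def AsymptotesToOneLine (γ : Set (ℝ × ℝ)) (a : ℝ) (l : Filter ℝ) : Prop :=
  ∃ c : ℝ → ℝ × ℝ, IsCurveParam (Iic 0) c γ ∧ Tendsto c atBot (𝓝 a ×ˢ l)

/-- `γ ⊆ R`, and `R \ γ` has exactly two connected components. -/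
def SeparatesInTwo (γ R : Set (ℝ × ℝ)) : Prop :=
  γ ⊆ R ∧ Nat.card (ConnectedComponents ↥(R \ γ)) = 2

/-- `γ` has positive distance from the vertical line `x = a`. -/
def StaysAwayFrom (γ : Set (ℝ × ℝ)) (a : ℝ) : Prop :=
  ∃ δ > 0, ∀ p ∈ γ, δ ≤ |p.1 - a|

end

end PomeranskySenkov

/-!
On a hyperbola `x y = const` the equation `H = 0` is linear in `x + ν y`, so it prescribes the sum
of two numbers whose product is known. At most one solution lies in the lower or upper part of the
strip, and each part of the singular set is a graph over an interval of values of `ν x y`. One end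
of the interval is `ν x y = 1`, where the coefficient of `x + ν y` vanishes; there `y` is infinite
and `x → 0`. The other end is at infinity, where `x → x_*`, unless the graph leaves the strip
through the line `x = 1` before.

Along each hyperbola `H` changes sign at most once within a part of the strip, so the complement of
the curve in it consists of two sets that are fibred over intervals with intervals as fibres, hence
connected.
-/

namespace PomeranskySenkov

variable {k m ε c μ ν l a b t q u v x y : ℝ}

/-! ### Level sets of the normal form -/

/-- The normal form of `H` on both parts of the strip: up to the factor `2λ`, it is `H` at the
point `(x, y)` with `v = ε ν y`, where `ε = -1` in the lower part and `ε = 1` in the upper one. -/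
def signedPoly (k m ε x v : ℝ) : ℝ := k * (x * v) ^ 2 + m - (v + ε * x) * (x * v - ε)

lemma signedPoly_div (hv : v ≠ 0) :
    signedPoly k m ε (q / v) v = k * q ^ 2 + m - (v + ε * (q / v)) * (q - ε) := by
  rw [signedPoly, div_mul_cancel₀ q hv]

lemma signedPoly_div_sub (hu : u ≠ 0) (hv : v ≠ 0) :
    signedPoly k m ε (q / u) u - signedPoly k m ε (q / v) v =
      (q - ε) * (v - u) * (u - ε * (q / v)) / u := by
  rw [signedPoly_div hu, signedPoly_div hv]
  field_simp
  ring

lemma signedPoly_one_sub :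
    signedPoly k m ε 1 (x * v) - signedPoly k m ε x v = (x * v - ε) * (1 - x) * (v - ε) := by
  unfold signedPoly
  ring

/-- The geometry of the zero set common to both parts of the strip: where `signedPoly k m ε` is
nonpositive and `c ≤ v`, the point lies in the open region `c < v`, away from the line `x = -1`,
and on a level set of `x * v` beyond the asymptotic level `ε`. -/
structure IsBranch (k m ε c : ℝ) : Prop where
  sign : ε = 1 ∨ ε = -1
  pos : 0 < c
  lt_one : c < 1
  const_pos : 0 < m
  sum_pos : 0 < k + m
  of_nonpos : ∀ x ∈ Icc (-1 : ℝ) 1, ∀ v, c ≤ v → signedPoly k m ε x v ≤ 0 →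
    c < v ∧ -c < x ∧ ε < x * v

namespace IsBranch

lemma sq_eq_one (h : IsBranch k m ε c) : ε ^ 2 = 1 := by
  rcases h.sign with rfl | rfl <;> norm_num

lemma le_one (h : IsBranch k m ε c) : ε ≤ 1 := by
  rcases h.sign with rfl | rfl <;> norm_num

lemma lt_of_nonpos (h : IsBranch k m ε c) (hx : x ∈ Icc (-1) 1) (hv : c ≤ v)
    (hG : signedPoly k m ε x v ≤ 0) : ε * x < v ∧ ε < v := by
  obtain ⟨hcv, hcx, hq⟩ := h.of_nonpos x hx v hv hG
  have hv0 : 0 < v := h.pos.trans hcv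
  have hεv : ε < v := hq.trans_le (mul_le_of_le_one_left hv0.le hx.2)
  refine ⟨?_, hεv⟩
  rcases h.sign with rfl | rfl <;> linarith [hx.2]

end IsBranch

lemma div_mem_Icc (hv : 0 < v) (hq : |q| ≤ v) : q / v ∈ Icc (-1 : ℝ) 1 := by
  rw [mem_Icc, ← abs_le, abs_div, abs_of_pos hv]
  exact div_le_one_of_le₀ hq hv.le

namespace IsBranch

lemma signedPoly_div_le (h : IsBranch k m ε c) (hu : c ≤ u) (hq : |q| ≤ u) (huv : u ≤ v)
    (hG : signedPoly k m ε (q / u) u ≤ 0) :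
    signedPoly k m ε (q / v) v ≤ signedPoly k m ε (q / u) u := by
  have hu0 : 0 < u := h.pos.trans_le hu
  have hx := div_mem_Icc hu0 hq
  have hεq : ε < q := by
    simpa only [div_mul_cancel₀ q hu0.ne'] using (h.of_nonpos _ hx u hu hG).2.2
  have hprod : ε * (q / v) ≤ u := by
    have hlt : ε * q < u * u := by
      have := (h.lt_of_nonpos hx hu hG).1
      rwa [← mul_div_assoc, div_lt_iff₀ hu0] at this
    rw [← mul_div_assoc, div_le_iff₀ (hu0.trans_le huv)]
    exact hlt.le.trans (mul_le_mul_of_nonneg_left huv hu0.le)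
  rw [← sub_nonneg, signedPoly_div_sub hu0.ne' (hu0.trans_le huv).ne']
  exact div_nonneg (mul_nonneg (mul_nonneg (sub_pos.2 hεq).le (sub_nonneg.2 huv))
    (sub_nonneg.2 hprod)) hu0.le

lemma ordConnected_pos (h : IsBranch k m ε c) :
    OrdConnected {v | c < v ∧ |q| ≤ v ∧ 0 < signedPoly k m ε (q / v) v} := by
  refine ⟨fun u hu v hv w hw => ⟨hu.1.trans_le hw.1, hu.2.1.trans hw.1, ?_⟩⟩
  by_contra! hG
  exact ((h.signedPoly_div_le (hu.1.le.trans hw.1) (hu.2.1.trans hw.1) hw.2 hG).trans hG).not_gt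
    hv.2.2

lemma ordConnected_neg (h : IsBranch k m ε c) :
    OrdConnected {v | c < v ∧ |q| ≤ v ∧ signedPoly k m ε (q / v) v < 0} :=
  ⟨fun _ hu _ _ _ hw => ⟨hu.1.trans_le hw.1, hu.2.1.trans hw.1,
    (h.signedPoly_div_le hu.1.le hu.2.1 hw.1 hu.2.2.le).trans_lt hu.2.2⟩⟩

lemma rim_pos_or_eq (h : IsBranch k m ε c) :
    0 < signedPoly k m ε (q / max c |q|) (max c |q|) ∨
      0 < q ∧ signedPoly k m ε (q / max c |q|) (max c |q|) = signedPoly k m ε 1 q := by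
  have hr : 0 < max c |q| := h.pos.trans_le (le_max_left _ _)
  have hx := div_mem_Icc hr (le_max_right c |q|)
  rw [or_iff_not_imp_left, not_lt]
  intro hG
  obtain ⟨hc, hcx, -⟩ := h.of_nonpos _ hx _ (le_max_left _ _) hG
  have hmax : max c |q| = |q| := max_eq_right (lt_max_iff.1 hc |>.resolve_left (lt_irrefl c)).le
  rw [hmax] at hcx hr ⊢
  have hq : 0 < q := by
    by_contra! hq
    rw [abs_of_nonpos hq, div_neg, div_self (abs_pos.1 hr)] at hcx
    linarith [h.lt_one]
  rw [abs_of_pos hq, div_self hq.ne']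
  exact ⟨hq, rfl⟩

lemma rim_nonneg (h : IsBranch k m ε c) (hq : 0 ≤ signedPoly k m ε 1 q) :
    0 ≤ signedPoly k m ε (q / max c |q|) (max c |q|) :=
  h.rim_pos_or_eq.elim le_of_lt fun hrim => hrim.2 ▸ hq

lemma rim_pos (h : IsBranch k m ε c) (hq : 0 < q → 0 < signedPoly k m ε 1 q) :
    0 < signedPoly k m ε (q / max c |q|) (max c |q|) :=
  h.rim_pos_or_eq.elim id fun hrim => hrim.2 ▸ hq hrim.1

end IsBranch

/-- For fixed `q = x * v`, the value of `v + ε * x` at which `signedPoly k m ε x v` vanishes. -/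
noncomputable def levelSum (k m ε q : ℝ) : ℝ := (k * q ^ 2 + m) / (q - ε)

/-- The discriminant of the quadratic equation with roots `v` and `ε * x` when `x * v = q`. -/
noncomputable def levelDisc (k m ε q : ℝ) : ℝ := levelSum k m ε q ^ 2 - 4 * ε * q

/-- The value of `v` at the point of the zero set of `signedPoly k m ε` with `x * v = q`. -/
noncomputable def height (k m ε q : ℝ) : ℝ := (levelSum k m ε q + √(levelDisc k m ε q)) / 2

lemma signedPoly_eq_mul_levelSum (hq : x * v ≠ ε) : signedPoly k m ε x v =
    (x * v - ε) * (levelSum k m ε (x * v) - (v + ε * x)) := by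
  rw [signedPoly, levelSum, mul_sub (x * v - ε), mul_div_cancel₀ _ (sub_ne_zero.2 hq),
    mul_comm (v + ε * x)]

lemma signedPoly_height (hq : q ≠ ε) (hd : 0 ≤ levelDisc k m ε q) (hh : height k m ε q ≠ 0) :
    signedPoly k m ε (q / height k m ε q) (height k m ε q) = 0 := by
  have hroot : height k m ε q ^ 2 - levelSum k m ε q * height k m ε q + ε * q = 0 := by
    have := Real.sq_sqrt hd
    rw [levelDisc] at this
    rw [height, levelDisc]
    linear_combination this / 4
  rw [signedPoly_eq_mul_levelSum (by rwa [div_mul_cancel₀ q hh]), div_mul_cancel₀ q hh,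
    mul_eq_zero]
  right
  field_simp
  linear_combination -hroot

namespace IsBranch

lemma levelSum_of_eq_zero (h : IsBranch k m ε c) (hx : x ∈ Icc (-1) 1) (hv : c ≤ v)
    (hG : signedPoly k m ε x v = 0) : levelSum k m ε (x * v) = v + ε * x := by
  have hq := (h.of_nonpos x hx v hv hG.le).2.2
  rw [signedPoly_eq_mul_levelSum hq.ne'] at hG
  exact sub_eq_zero.1 ((mul_eq_zero.1 hG).resolve_left (sub_pos.2 hq).ne')

lemma height_of_eq_zero (h : IsBranch k m ε c) (hx : x ∈ Icc (-1) 1) (hv : c ≤ v)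
    (hG : signedPoly k m ε x v = 0) : height k m ε (x * v) = v := by
  have hsum := h.levelSum_of_eq_zero hx hv hG
  have hdisc : levelDisc k m ε (x * v) = (v - ε * x) ^ 2 := by
    rw [levelDisc, hsum]
    ring
  rw [height, hdisc, hsum, Real.sqrt_sq (sub_nonneg.2 (h.lt_of_nonpos hx hv hG.le).1.le)]
  ring

lemma nonneg_signedPoly_one_of_eq_zero (h : IsBranch k m ε c) (hx : x ∈ Icc (-1) 1) (hv : c ≤ v)
    (hG : signedPoly k m ε x v = 0) : 0 ≤ signedPoly k m ε 1 (x * v) := by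
  rw [← sub_add_cancel (signedPoly k m ε 1 (x * v)) (signedPoly k m ε x v), signedPoly_one_sub, hG,
    add_zero]
  exact mul_nonneg (mul_nonneg (sub_pos.2 (h.of_nonpos x hx v hv hG.le).2.2).le
    (sub_nonneg.2 hx.2)) (sub_pos.2 (h.lt_of_nonpos hx hv hG.le).2).le

section Height

variable (h : IsBranch k m ε c) (hεq : ε < q) (hq : 0 ≤ signedPoly k m ε 1 q)
include h hεq hq

lemma rim_add_le_levelSum : max c |q| + ε * (q / max c |q|) ≤ levelSum k m ε q := by
  have hr : max c |q| ≠ 0 := (h.pos.trans_le (le_max_left _ _)).ne'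
  have hG := h.rim_nonneg hq
  rwa [signedPoly_eq_mul_levelSum (by rw [div_mul_cancel₀ q hr]; exact hεq.ne'),
    div_mul_cancel₀ q hr, mul_nonneg_iff_of_pos_left (sub_pos.2 hεq), sub_nonneg] at hG

lemma sq_le_levelDisc : (levelSum k m ε q - 2 * max c |q|) ^ 2 ≤ levelDisc k m ε q := by
  have hr : 0 < max c |q| := h.pos.trans_le (le_max_left _ _)
  have hsum := mul_le_mul_of_nonneg_left (h.rim_add_le_levelSum hεq hq) hr.le
  have hprod : max c |q| * (ε * (q / max c |q|)) = ε * q := by field_simp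
  rw [levelDisc]
  linarith

lemma rim_le_height : max c |q| ≤ height k m ε q := by
  have hsqrt := Real.abs_le_sqrt (h.sq_le_levelDisc hεq hq)
  rw [height]
  linarith [neg_abs_le (levelSum k m ε q - 2 * max c |q|)]

lemma height_pos : 0 < height k m ε q :=
  h.pos.trans_le ((le_max_left _ _).trans (h.rim_le_height hεq hq))

lemma levelDisc_pos : 0 < levelDisc k m ε q := by
  refine ((sq_nonneg _).trans (h.sq_le_levelDisc hεq hq)).lt_of_ne fun hdisc => ?_
  have hr : 0 < max c |q| := h.pos.trans_le (le_max_left _ _)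
  have hrq : max c |q| * (q / max c |q|) = q := by field_simp
  have hsq : (levelSum k m ε q - 2 * max c |q|) ^ 2 = 0 :=
    ((h.sq_le_levelDisc hεq hq).trans hdisc.ge).antisymm (sq_nonneg _)
  have hsum : levelSum k m ε q = 2 * max c |q| :=
    sub_eq_zero.1 ((pow_eq_zero_iff two_ne_zero).1 hsq)
  have hdouble : max c |q| = ε * (q / max c |q|) := by
    rw [levelDisc, hsum] at hdisc
    apply mul_left_cancel₀ hr.ne'
    linear_combination -hdisc / 4 - ε * hrq
  have hG : signedPoly k m ε (q / max c |q|) (max c |q|) = 0 := by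
    rw [signedPoly_eq_mul_levelSum (by rw [mul_comm, hrq]; exact hεq.ne'), mul_comm _ (max c _),
      hrq, hsum, ← hdouble]
    ring
  exact (h.lt_of_nonpos (div_mem_Icc hr (le_max_right _ _)) (le_max_left _ _) hG.le).1.ne'
    hdouble

lemma signedPoly_height_eq_zero :
    signedPoly k m ε (q / height k m ε q) (height k m ε q) = 0 :=
  signedPoly_height hεq.ne' (h.levelDisc_pos hεq hq).le (h.height_pos hεq hq).ne'

lemma div_height_mem_Icc : q / height k m ε q ∈ Icc (-1 : ℝ) 1 :=
  div_mem_Icc (h.height_pos hεq hq) ((le_max_right _ _).trans (h.rim_le_height hεq hq))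

lemma lt_height : c < height k m ε q :=
  (h.of_nonpos _ (h.div_height_mem_Icc hεq hq) _
    ((le_max_left _ _).trans (h.rim_le_height hεq hq)) (h.signedPoly_height_eq_zero hεq hq).le).1

end Height

end IsBranch

/-- The part of the strip `x ∈ [-1, 1]` in which the normalised ordinate `v = μ y` exceeds `c`. -/
def branchRegion (c μ : ℝ) : Set (ℝ × ℝ) := {p | p.1 ∈ Icc (-1) 1 ∧ c < μ * p.2}

/-- The zeros of `signedPoly k m ε` in `branchRegion c μ`. -/
def branchZeros (k m ε c μ : ℝ) : Set (ℝ × ℝ) :=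
  {p ∈ branchRegion c μ | signedPoly k m ε p.1 (μ * p.2) = 0}

/-- The point `(x, y)` of the zero set on the level set `x * v = q`, where `v = μ y`. -/
noncomputable def branchPoint (k m ε μ q : ℝ) : ℝ × ℝ :=
  (q / height k m ε q, height k m ε q / μ)

/-- The levels `q = x * v` attained on the zero set: on the level set of `q`, it is reached within
the strip precisely if `signedPoly k m ε` is still nonnegative on the edge `x = 1`. -/
def branchLevels (k m ε : ℝ) : Set ℝ := {q | ε < q ∧ 0 ≤ signedPoly k m ε 1 q}

namespace IsBranch

lemma branchZeros_eq_image (h : IsBranch k m ε c) (hμ : μ ≠ 0) :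
    branchZeros k m ε c μ = branchPoint k m ε μ '' branchLevels k m ε := by
  ext ⟨x, y⟩
  constructor
  · rintro ⟨⟨hx, hv⟩, hG⟩
    have hv0 : μ * y ≠ 0 := (h.pos.trans hv).ne'
    refine ⟨x * (μ * y), ⟨(h.of_nonpos x hx _ hv.le hG.le).2.2,
      h.nonneg_signedPoly_one_of_eq_zero hx hv.le hG⟩, ?_⟩
    rw [branchPoint, h.height_of_eq_zero hx hv.le hG, mul_div_cancel_right₀ x hv0,
      mul_div_cancel_left₀ y hμ]
  · rintro ⟨q, ⟨hεq, hq⟩, hpoint⟩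
    rw [← hpoint, branchZeros, branchRegion, branchPoint]
    simp only [mem_ofPred_eq, mul_div_cancel₀ _ hμ]
    exact ⟨⟨h.div_height_mem_Icc hεq hq, h.lt_height hεq hq⟩, h.signedPoly_height_eq_zero hεq hq⟩

lemma fst_mul_branchPoint (h : IsBranch k m ε c) (hμ : μ ≠ 0) (hq : q ∈ branchLevels k m ε) :
    (branchPoint k m ε μ q).1 * (μ * (branchPoint k m ε μ q).2) = q := by
  rw [branchPoint, mul_div_cancel₀ _ hμ, div_mul_cancel₀ _ (h.height_pos hq.1 hq.2).ne']

lemma contDiffAt_branchPoint (h : IsBranch k m ε c) (hq : q ∈ branchLevels k m ε) :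
    ContDiffAt ℝ ∞ (branchPoint k m ε μ) q := by
  have hsum : ContDiffAt ℝ ∞ (levelSum k m ε) q := by
    unfold levelSum
    exact ContDiffAt.div (by fun_prop) (by fun_prop) (sub_ne_zero.2 hq.1.ne')
  have hdisc : ContDiffAt ℝ ∞ (levelDisc k m ε) q := by
    unfold levelDisc
    fun_prop
  have hheight : ContDiffAt ℝ ∞ (height k m ε) q :=
    (hsum.add (hdisc.sqrt (h.levelDisc_pos hq.1 hq.2).ne')).div_const 2
  exact (contDiffAt_id.div hheight (h.height_pos hq.1 hq.2).ne').prodMk (hheight.div_const μ)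

end IsBranch

/-! ### Parametrisation of the zero set -/

lemma isEmbedding_add_mul_exp {C : ℝ} (a : ℝ) (hC : C ≠ 0) :
    IsEmbedding fun t : ℝ => a + C * Real.exp t :=
  ((Homeomorph.mulLeft₀ C hC).trans (Homeomorph.addLeft a)).isEmbedding.comp
    Real.isOpenEmbedding_exp.isEmbedding

lemma isCurveParam_of_comp_eqOn {I : Set ℝ} {γ : Set (ℝ × ℝ)} {f : ℝ × ℝ → ℝ} {c : ℝ → ℝ × ℝ}
    {φ φ' : ℝ → ℝ} (hI : UniqueDiffOn ℝ I) (hf : Differentiable ℝ f) (hc : ContDiffOn ℝ ∞ c I)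
    (hφ : IsEmbedding φ) (hφ' : ∀ t ∈ I, HasDerivAt φ (φ' t) t) (hφ₀ : ∀ t ∈ I, φ' t ≠ 0)
    (hfc : EqOn (f ∘ c) φ I) (himage : c '' I = γ) : IsCurveParam I c γ where
  contDiffOn := hc
  regular t ht hzero := by
    have hderiv : HasDerivWithinAt c 0 I t :=
      hzero ▸ (hc.differentiableOn (by simp) t ht).hasDerivWithinAt
    have hcomp : HasDerivWithinAt (f ∘ c) 0 I t := by
      simpa only [map_zero] using (hf (c t)).hasFDerivAt.comp_hasDerivWithinAt t hderiv
    exact hφ₀ t ht <| (hI t ht).eq_deriv _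
      ((hφ' t ht).hasDerivWithinAt.congr (fun s hs => hfc hs) (hfc ht)) hcomp
  isEmbedding := by
    refine IsEmbedding.of_comp hc.continuousOn.domRestrict hf.continuous ?_
    have hrestrict : f ∘ (fun t : I => c t) = φ ∘ ((↑) : I → ℝ) := funext fun t => hfc t.2
    rw [hrestrict]
    exact hφ.comp .subtypeVal
  image_eq := himage

namespace IsBranch

lemma isCurveParam (h : IsBranch k m ε c) {I : Set ℝ} {C : ℝ} (hμ : μ ≠ 0) (hC : C ≠ 0)
    (hI : UniqueDiffOn ℝ I) (himage : (fun t => ε + C * Real.exp t) '' I = branchLevels k m ε) :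
    IsCurveParam I (fun t => branchPoint k m ε μ (ε + C * Real.exp t))
      (branchZeros k m ε c μ) := by
  have hmem : ∀ t ∈ I, ε + C * Real.exp t ∈ branchLevels k m ε :=
    fun t ht => himage ▸ mem_image_of_mem _ ht
  refine isCurveParam_of_comp_eqOn (f := fun p => p.1 * (μ * p.2)) hI (by fun_prop) (fun t ht => ?_)
    (isEmbedding_add_mul_exp ε hC)
    (fun t _ => ((Real.hasDerivAt_exp t).const_mul C).const_add ε)
    (fun t _ => mul_ne_zero hC (Real.exp_ne_zero t))
    (fun t ht => h.fst_mul_branchPoint hμ (hmem t ht)) ?_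
  · have hlevel : ContDiffAt ℝ ∞ (fun t => ε + C * Real.exp t) t := by fun_prop
    exact ((h.contDiffAt_branchPoint (hmem t ht)).comp t hlevel).contDiffWithinAt
  · rw [h.branchZeros_eq_image hμ, ← himage, image_image]

lemma tendsto_branchPoint_nhdsGT (h : IsBranch k m ε c) {l : Filter ℝ}
    (hl : Tendsto (· / μ) atTop l) :
    Tendsto (branchPoint k m ε μ) (𝓝[>] ε) (𝓝 0 ×ˢ l) := by
  have hnum : Tendsto (fun q => k * q ^ 2 + m) (𝓝[>] ε) (𝓝 (k + m)) := by
    have hcont : Continuous fun q : ℝ => k * q ^ 2 + m := by fun_prop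
    simpa only [h.sq_eq_one, mul_one] using (hcont.tendsto ε).mono_left nhdsWithin_le_nhds
  have hden : Tendsto (fun q => (q - ε)⁻¹) (𝓝[>] ε) atTop := by
    have hcont : Continuous fun q : ℝ => q - ε := by fun_prop
    refine tendsto_inv_nhdsGT_zero.comp (tendsto_nhdsWithin_iff.2 ⟨?_, ?_⟩)
    · simpa only [sub_self] using (hcont.tendsto ε).mono_left nhdsWithin_le_nhds
    · exact eventually_mem_nhdsWithin.mono fun q hq => mem_Ioi.2 (sub_pos.2 hq)
  have hsum : Tendsto (levelSum k m ε) (𝓝[>] ε) atTop := hnum.pos_mul_atTop h.sum_pos hden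
  have hheight : Tendsto (height k m ε) (𝓝[>] ε) atTop :=
    tendsto_atTop_mono (fun q => div_le_div_of_nonneg_right
      (le_add_of_nonneg_right (Real.sqrt_nonneg _)) zero_le_two)
      (hsum.atTop_div_const zero_lt_two)
  exact (tendsto_nhdsWithin_of_tendsto_nhds tendsto_id |>.div_atTop hheight).prodMk
    (hl.comp hheight)

end IsBranch

lemma tendsto_height_div_atTop (hk : 0 ≤ k) :
    Tendsto (fun q => height k m ε q / q) atTop (𝓝 k) := by
  have hinv : Tendsto (fun q : ℝ => q⁻¹) atTop (𝓝 0) := tendsto_inv_atTop_zero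
  have hsum : Tendsto (fun q => levelSum k m ε q / q) atTop (𝓝 k) := by
    have hlim : Tendsto (fun q : ℝ => (k + m * q⁻¹ ^ 2) / (1 - ε * q⁻¹)) atTop
        (𝓝 ((k + m * 0 ^ 2) / (1 - ε * 0))) :=
      ((hinv.pow 2).const_mul m |>.const_add k).div ((hinv.const_mul ε).const_sub 1) (by simp)
    have hvalue : (k + m * 0 ^ 2) / (1 - ε * 0) = k := by simp
    rw [hvalue] at hlim
    refine hlim.congr' ?_
    filter_upwards [eventually_gt_atTop 0, eventually_gt_atTop ε] with q hq hqε
    rw [levelSum]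
    have := sub_pos.2 hqε
    field_simp
  have hdisc : Tendsto (fun q => levelDisc k m ε q / q ^ 2) atTop (𝓝 (k ^ 2)) := by
    have hlim : Tendsto (fun q => (levelSum k m ε q / q) ^ 2 - 4 * ε * q⁻¹) atTop
        (𝓝 (k ^ 2 - 4 * ε * 0)) := (hsum.pow 2).sub (hinv.const_mul _)
    rw [mul_zero, sub_zero] at hlim
    refine hlim.congr' ?_
    filter_upwards [eventually_gt_atTop 0] with q hq
    rw [levelDisc]
    field_simp
  have hlim : Tendsto (fun q => (levelSum k m ε q / q + √(levelDisc k m ε q / q ^ 2)) / 2) atTop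
      (𝓝 ((k + √(k ^ 2)) / 2)) := (hsum.add hdisc.sqrt).div_const 2
  rw [Real.sqrt_sq hk, add_self_div_two] at hlim
  refine hlim.congr' ?_
  filter_upwards [eventually_gt_atTop 0] with q hq
  rw [height, Real.sqrt_div' _ (sq_nonneg q), Real.sqrt_sq hq.le]
  ring

lemma tendsto_branchPoint_atTop (hk : 0 < k) {l : Filter ℝ} (hl : Tendsto (· / μ) atTop l) :
    Tendsto (branchPoint k m ε μ) atTop (𝓝 k⁻¹ ×ˢ l) := by
  have hdiv := tendsto_height_div_atTop (m := m) (ε := ε) hk.le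
  have hheight : Tendsto (height k m ε) atTop atTop :=
    (hdiv.pos_mul_atTop hk tendsto_id).congr' <| by
      filter_upwards [eventually_ne_atTop 0] with q hq using div_mul_cancel₀ _ hq
  have hx : Tendsto (fun q => q / height k m ε q) atTop (𝓝 k⁻¹) := by
    simpa only [inv_div] using hdiv.inv₀ hk.ne'
  exact hx.prodMk (hl.comp hheight)

lemma tendsto_add_mul_exp_atBot {C : ℝ} (a : ℝ) (hC : 0 < C) :
    Tendsto (fun t => a + C * Real.exp t) atBot (𝓝[>] a) := by
  refine tendsto_nhdsWithin_iff.2 ⟨?_, Eventually.of_forall fun t => ?_⟩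
  · simpa only [mul_zero, add_zero] using (Real.tendsto_exp_atBot.const_mul C).const_add a
  · exact lt_add_of_pos_right a (mul_pos hC (Real.exp_pos t))

lemma signedPoly_one_left (hε : ε ^ 2 = 1) : signedPoly k m ε 1 v = (k - 1) * v ^ 2 + m + 1 := by
  rw [signedPoly]
  linear_combination hε

lemma image_add_mul_exp_univ {C : ℝ} (a : ℝ) (hC : 0 < C) :
    (fun t => a + C * Real.exp t) '' univ = Ioi a := by
  ext q
  refine ⟨?_, fun hq => ⟨Real.log ((q - a) / C), mem_univ _, ?_⟩⟩
  · rintro ⟨t, -, rfl⟩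
    exact lt_add_of_pos_right a (mul_pos hC (Real.exp_pos t))
  · dsimp only
    rw [Real.exp_log (div_pos (sub_pos.2 hq) hC), mul_div_cancel₀ _ hC.ne', add_sub_cancel]

lemma image_add_mul_exp_Iic_zero {C : ℝ} (a : ℝ) (hC : 0 < C) :
    (fun t => a + C * Real.exp t) '' Iic 0 = Ioc a (a + C) := by
  ext q
  constructor
  · rintro ⟨t, ht, rfl⟩
    exact ⟨lt_add_of_pos_right a (mul_pos hC (Real.exp_pos t)),
      add_le_add_right (mul_le_of_le_one_right hC.le (Real.exp_le_one_iff.2 ht)) a⟩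
  · rintro ⟨hq, hqC⟩
    obtain ⟨t, -, rfl⟩ := (image_add_mul_exp_univ a hC).ge hq
    refine mem_image_of_mem _ (mem_Iic.2 (Real.exp_le_one_iff.1 ?_))
    exact le_of_mul_le_mul_left (by linarith) hC

namespace IsBranch

lemma branchLevels_of_one_le (h : IsBranch k m ε c) (hk : 1 ≤ k) :
    branchLevels k m ε = Ioi ε := by
  refine subset_antisymm (fun q hq => hq.1) fun q hq => ⟨hq, ?_⟩
  rw [signedPoly_one_left h.sq_eq_one]
  linarith [mul_nonneg (sub_nonneg.2 hk) (sq_nonneg q), h.const_pos]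

theorem asymptotesToTwoLines (h : IsBranch k m ε c) (hμ : μ ≠ 0) (hk : 1 ≤ k) {l : Filter ℝ}
    (hl : Tendsto (· / μ) atTop l) :
    AsymptotesToTwoLines (branchZeros k m ε c μ) 0 k⁻¹ l :=
  ⟨_, h.isCurveParam hμ one_ne_zero uniqueDiffOn_univ
      ((image_add_mul_exp_univ ε one_pos).trans (h.branchLevels_of_one_le hk).symm),
    (h.tendsto_branchPoint_nhdsGT hl).comp (tendsto_add_mul_exp_atBot ε one_pos),
    (tendsto_branchPoint_atTop (one_pos.trans_le hk) hl).comp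
      (tendsto_atTop_add_const_left _ ε (Real.tendsto_exp_atTop.const_mul_atTop one_pos))⟩

lemma exists_signedPoly_one_eq (h : IsBranch k m ε c) (hk : k < 1) :
    ∃ B > 1, ∀ v, signedPoly k m ε 1 v = (1 - k) * (B ^ 2 - v ^ 2) := by
  have hratio : 1 < (m + 1) / (1 - k) := by
    rw [one_lt_div (sub_pos.2 hk)]
    linarith [h.sum_pos]
  refine ⟨√((m + 1) / (1 - k)), Real.lt_sqrt_of_sq_lt (by rwa [one_pow]), fun v => ?_⟩
  rw [signedPoly_one_left h.sq_eq_one, Real.sq_sqrt (one_pos.trans hratio).le, mul_sub,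
    mul_div_cancel₀ _ (sub_pos.2 hk).ne']
  ring

lemma exists_branchLevels_eq_Ioc (h : IsBranch k m ε c) (hk : k < 1) :
    ∃ C > 0, branchLevels k m ε = Ioc ε (ε + C) := by
  obtain ⟨B, hB, hpoly⟩ := h.exists_signedPoly_one_eq hk
  refine ⟨B - ε, by linarith [h.le_one], ?_⟩
  ext q
  rw [add_sub_cancel]
  refine and_congr_right fun hq => ?_
  have hεq : -B < q := by rcases h.sign with rfl | rfl <;> linarith
  rw [hpoly, mul_nonneg_iff_of_pos_left (sub_pos.2 hk), sub_nonneg]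
  constructor
  · exact fun hqB => (abs_le_of_sq_le_sq' hqB (by linarith)).2
  · exact fun hqB => sq_le_sq' hεq.le hqB

theorem asymptotesToOneLine (h : IsBranch k m ε c) (hμ : μ ≠ 0) (hk : k < 1) {l : Filter ℝ}
    (hl : Tendsto (· / μ) atTop l) :
    AsymptotesToOneLine (branchZeros k m ε c μ) 0 l := by
  obtain ⟨C, hC, hlevels⟩ := h.exists_branchLevels_eq_Ioc hk
  exact ⟨_, h.isCurveParam hμ hC.ne' (uniqueDiffOn_Iic 0)
      ((image_add_mul_exp_Iic_zero ε hC).trans hlevels.symm),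
    (h.tendsto_branchPoint_nhdsGT hl).comp (tendsto_add_mul_exp_atBot ε hC)⟩

end IsBranch

lemma AsymptotesToTwoLines.isConnectedCurve {γ : Set (ℝ × ℝ)} {a b : ℝ} {l : Filter ℝ}
    (h : AsymptotesToTwoLines γ a b l) : IsConnectedCurve γ :=
  let ⟨c, hc, _⟩ := h
  ⟨univ, c, ordConnected_univ, nontrivial_univ, hc⟩

lemma AsymptotesToOneLine.isConnectedCurve {γ : Set (ℝ × ℝ)} {a : ℝ} {l : Filter ℝ}
    (h : AsymptotesToOneLine γ a l) : IsConnectedCurve γ :=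
  let ⟨c, hc, _⟩ := h
  ⟨Iic 0, c, ordConnected_Iic, ⟨-1, by simp, 0, by simp, by simp⟩, hc⟩

namespace IsBranch

theorem isConnectedCurve (h : IsBranch k m ε c) (hμ : μ ≠ 0) :
    IsConnectedCurve (branchZeros k m ε c μ) :=
  (le_or_gt 1 k).elim (fun hk => (h.asymptotesToTwoLines hμ hk tendsto_map).isConnectedCurve)
    fun hk => (h.asymptotesToOneLine hμ hk tendsto_map).isConnectedCurve

theorem existsUnique_fst_eq_one (h : IsBranch k m ε c) (hμ : μ ≠ 0) (hk : k < 1) :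
    ∃! p, p ∈ branchZeros k m ε c μ ∧ p.1 = 1 := by
  obtain ⟨B, hB, hpoly⟩ := h.exists_signedPoly_one_eq hk
  have hcB : c < B := h.lt_one.trans hB
  refine ⟨(1, B / μ), ⟨⟨⟨by norm_num, ?_⟩, ?_⟩, rfl⟩, ?_⟩
  · rwa [mul_div_cancel₀ _ hμ]
  · rw [mul_div_cancel₀ _ hμ, hpoly, sub_self, mul_zero]
  · rintro ⟨x, y⟩ ⟨⟨⟨-, hv⟩, hG⟩, rfl⟩
    rw [hpoly, mul_eq_zero_iff_left (sub_pos.2 hk).ne', sub_eq_zero] at hG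
    rw [(sq_eq_sq₀ (h.pos.trans hcB).le (h.pos.trans hv).le).1 hG, mul_div_cancel_left₀ _ hμ]

theorem fst_ne_one (h : IsBranch k m ε c) (hk : 1 ≤ k) {p : ℝ × ℝ}
    (hp : p ∈ branchZeros k m ε c μ) : p.1 ≠ 1 := by
  intro hx
  have hG := hp.2
  rw [hx, signedPoly_one_left h.sq_eq_one] at hG
  linarith [mul_nonneg (sub_nonneg.2 hk) (sq_nonneg (μ * p.2)), h.const_pos]

theorem staysAwayFrom_neg_one (h : IsBranch k m ε c) :
    StaysAwayFrom (branchZeros k m ε c μ) (-1) := by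
  refine ⟨1 - c, sub_pos.2 h.lt_one, fun p hp => ?_⟩
  have hcx := (h.of_nonpos _ hp.1.1 _ hp.1.2.le hp.2.le).2.1
  exact le_abs.2 (.inl (by linarith))

theorem staysAwayFrom_one (h : IsBranch k m ε c) (hk : 1 < k) :
    StaysAwayFrom (branchZeros k m ε c μ) 1 := by
  -- As a quadratic polynomial in `v`, `signedPoly k m ε x` has no real root at `x = 1`; by
  -- continuity of the discriminant this persists nearby.
  have hdiscrim : ∀ᶠ x in 𝓝 1, discrim (k * x ^ 2 - x) (ε * (1 - x ^ 2)) (m + x) < 0 := by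
    have hcont : Continuous fun x => discrim (k * x ^ 2 - x) (ε * (1 - x ^ 2)) (m + x) := by
      unfold discrim
      fun_prop
    refine (hcont.tendsto 1).eventually_lt_const ?_
    rw [discrim]
    linarith [mul_pos (sub_pos.2 hk) (add_pos h.const_pos one_pos)]
  obtain ⟨δ, hδ, hball⟩ := Metric.eventually_nhds_iff.1 hdiscrim
  refine ⟨δ, hδ, fun p hp => ?_⟩
  by_contra! hpδ
  refine quadratic_ne_zero_of_discrim_ne_sq (fun s => ?_) (μ * p.2) ?_
    (a := k * p.1 ^ 2 - p.1) (b := ε * (1 - p.1 ^ 2)) (c := m + p.1)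
  · exact ((hball hpδ).trans_le (sq_nonneg s)).ne
  · rw [← hp.2, signedPoly]
    linear_combination -p.1 * h.sq_eq_one

end IsBranch

/-! ### Complement of the zero set -/

lemma isPreconnected_of_isPreconnected_fibers {α β : Type*} [TopologicalSpace α]
    [TopologicalSpace β] {f : α → β} {s : Set α} (himage : IsPreconnected (f '' s))
    (hfiber : ∀ b, IsPreconnected (s ∩ f ⁻¹' {b}))
    (hopen : ∀ a ∈ s, 𝓝[f '' s] (f a) ≤ map f (𝓝[s] a)) : IsPreconnected s := by
  rintro u v hu hv huv ⟨a, has, hau⟩ ⟨b, hbs, hbv⟩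
  have hmem : ∀ w, IsOpen w → ∀ p ∈ s, p ∈ w → f p ∈ interior {y | y ∈ f '' s → y ∈ f '' (s ∩ w)} :=
    fun w hw p hp hpw => mem_interior_iff_mem_nhds.2 <| mem_inf_principal.1 <|
      hopen p hp (image_mem_map (inter_mem_nhdsWithin s (hw.mem_nhds hpw)))
  have hcover : f '' s ⊆ interior {y | y ∈ f '' s → y ∈ f '' (s ∩ u)} ∪
      interior {y | y ∈ f '' s → y ∈ f '' (s ∩ v)} := by
    rintro _ ⟨p, hp, rfl⟩
    exact (huv hp).imp (hmem u hu p hp) (hmem v hv p hp)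
  obtain ⟨y, hy, hyu, hyv⟩ := himage _ _ isOpen_interior isOpen_interior hcover
    ⟨f a, mem_image_of_mem f has, hmem u hu a has hau⟩
    ⟨f b, mem_image_of_mem f hbs, hmem v hv b hbs hbv⟩
  obtain ⟨p, ⟨hps, hpu⟩, hpy⟩ := interior_subset hyu hy
  obtain ⟨r, ⟨hrs, hrv⟩, hry⟩ := interior_subset hyv hy
  obtain ⟨z, hz, hzuv⟩ := hfiber y u v hu hv (inter_subset_left.trans huv)
    ⟨p, ⟨hps, hpy⟩, hpu⟩ ⟨r, ⟨hrs, hry⟩, hrv⟩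
  exact ⟨z, hz.1, hzuv⟩

lemma isPreconnected_inter_abs_le {O : Set (ℝ × ℝ)} (hO : IsOpen O)
    (hfiber : ∀ q, OrdConnected {v | (q, v) ∈ O ∧ |q| ≤ v})
    (himage : OrdConnected (Prod.fst '' {p ∈ O | |p.1| ≤ p.2})) :
    IsPreconnected {p ∈ O | |p.1| ≤ p.2} := by
  refine isPreconnected_of_isPreconnected_fibers himage.isPreconnected (fun q => ?_) ?_
  · have heq : {p ∈ O | |p.1| ≤ p.2} ∩ Prod.fst ⁻¹' {q} =
        Prod.mk q '' {v | (q, v) ∈ O ∧ |q| ≤ v} := by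
      ext ⟨r, v⟩
      constructor
      · rintro ⟨hp, rfl⟩
        exact ⟨v, hp, rfl⟩
      · rintro ⟨w, hw, hwp⟩
        obtain ⟨rfl, rfl⟩ := Prod.mk.inj hwp
        exact ⟨hw, rfl⟩
    rw [heq]
    exact (hfiber q).isPreconnected.image _ (by fun_prop)
  · rintro ⟨q, v⟩ ⟨hqO, hqv : |q| ≤ v⟩
    have hsection : Tendsto (fun r => (r, max v |r|)) (𝓝 q) (𝓝 (q, v)) := by
      have hcont : Continuous fun r : ℝ => (r, max v |r|) := by fun_prop
      simpa only [max_eq_left hqv] using hcont.tendsto q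
    refine le_map_of_right_inverse (Eventually.of_forall fun r => rfl)
      (tendsto_nhdsWithin_iff.2 ⟨hsection.mono_left nhdsWithin_le_nhds, ?_⟩)
    filter_upwards [nhdsWithin_le_nhds (hsection.eventually_mem (hO.mem_nhds hqO))] with r hr
    exact ⟨hr, le_max_right _ _⟩

lemma continuousOn_signedPoly_div (hc : 0 < c) :
    ContinuousOn (fun p : ℝ × ℝ => signedPoly k m ε (p.1 / p.2) p.2) {p | c < p.2} := by
  intro p hp
  have hp₀ : p.2 ≠ 0 := (hc.trans hp).ne'
  unfold signedPoly
  fun_prop (disch := assumption)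

lemma isPreconnected_branchRegion_inter {S : Set ℝ} (hc : 0 < c) (hμ : μ ≠ 0) (hS : IsOpen S)
    (hfiber : ∀ q, OrdConnected {v | c < v ∧ |q| ≤ v ∧ signedPoly k m ε (q / v) v ∈ S})
    (himage : OrdConnected {q | ∃ v, c < v ∧ |q| ≤ v ∧ signedPoly k m ε (q / v) v ∈ S}) :
    IsPreconnected {p ∈ branchRegion c μ | signedPoly k m ε p.1 (μ * p.2) ∈ S} := by
  have hopen : IsOpen {p : ℝ × ℝ | c < p.2 ∧ signedPoly k m ε (p.1 / p.2) p.2 ∈ S} :=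
    (continuousOn_signedPoly_div hc).isOpen_inter_preimage
      (isOpen_lt continuous_const continuous_snd) hS
  have hcone := isPreconnected_inter_abs_le hopen
    (fun q => by simpa only [mem_ofPred_eq, and_right_comm, and_assoc] using hfiber q) (by
      convert himage using 1
      ext q
      simp only [mem_image, mem_ofPred_eq, Prod.exists, exists_and_right, exists_eq_right]
      exact exists_congr fun v => by tauto)
  convert hcone.image (fun p => (p.1 / p.2, p.2 / μ)) ?_ using 1
  · ext ⟨x, y⟩
    constructor
    · rintro ⟨⟨hx, hv⟩, hG⟩
      have hv0 : 0 < μ * y := hc.trans hv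
      have hxv : |x * (μ * y)| ≤ μ * y := by
        rw [abs_mul, abs_of_pos hv0]
        exact mul_le_of_le_one_left hv0.le (abs_le.2 hx)
      have hdiv : x * (μ * y) / (μ * y) = x := mul_div_cancel_right₀ x hv0.ne'
      exact ⟨(x * (μ * y), μ * y), ⟨⟨hv, by rwa [hdiv]⟩, hxv⟩,
        Prod.ext hdiv (mul_div_cancel_left₀ y hμ)⟩
    · rintro ⟨⟨q, v⟩, ⟨⟨hv, hG⟩, hq⟩, hqv⟩
      obtain ⟨rfl, rfl⟩ := Prod.mk.inj hqv
      simp only [branchRegion, mem_ofPred_eq, mul_div_cancel₀ _ hμ]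
      exact ⟨⟨div_mem_Icc (hc.trans hv) hq, hv⟩, hG⟩
  · exact (continuousOn_fst.div continuousOn_snd fun p hp => (hc.trans hp.1.1).ne').prodMk
      (by fun_prop)

namespace IsBranch

lemma exists_signedPoly_neg_iff (h : IsBranch k m ε c) :
    (∃ v, c < v ∧ |q| ≤ v ∧ signedPoly k m ε (q / v) v < 0) ↔ ε < q := by
  constructor
  · rintro ⟨v, hv, hq, hG⟩
    have hv0 : 0 < v := h.pos.trans hv
    simpa only [div_mul_cancel₀ q hv0.ne'] using
      (h.of_nonpos _ (div_mem_Icc hv0 hq) v hv.le hG.le).2.2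
  · intro hq
    have hsum := abs_nonneg (levelSum k m ε q)
    set v := |q| + |levelSum k m ε q| + 2 with hv
    have hqv : |q| ≤ v := by linarith
    have hv0 : 0 < v := by positivity
    have hx : -1 ≤ ε * (q / v) := by
      have := div_mem_Icc hv0 hqv
      rcases h.sign with rfl | rfl <;> linarith [this.1, this.2]
    refine ⟨v, by linarith [abs_nonneg q, h.lt_one], hqv, ?_⟩
    rw [signedPoly_eq_mul_levelSum (by rw [div_mul_cancel₀ q hv0.ne']; exact hq.ne'),
      div_mul_cancel₀ q hv0.ne']
    exact mul_neg_of_pos_of_neg (sub_pos.2 hq)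
      (by linarith [le_abs_self (levelSum k m ε q), abs_nonneg q])

lemma signedPoly_one_pos_of_le_one (h : IsBranch k m ε c) (hq : 0 ≤ q) (hq1 : q ≤ 1) :
    0 < signedPoly k m ε 1 q := by
  have hsq : 0 ≤ (1 + m) * (1 - q ^ 2) :=
    mul_nonneg (by linarith [h.const_pos]) (sub_nonneg.2 (pow_le_one₀ hq hq1))
  rw [signedPoly_one_left h.sq_eq_one]
  nlinarith [mul_nonneg h.sum_pos.le (sq_nonneg q), h.sum_pos, h.const_pos]

lemma exists_signedPoly_pos_iff (h : IsBranch k m ε c) :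
    (∃ v, c < v ∧ |q| ≤ v ∧ 0 < signedPoly k m ε (q / v) v) ↔
      (0 < q → 0 < signedPoly k m ε 1 q) := by
  constructor
  · rintro ⟨v, hv, hqv, hG⟩ hq
    rcases le_or_gt q 1 with hq1 | hq1
    · exact h.signedPoly_one_pos_of_le_one hq.le hq1
    · have hv0 : 0 < v := h.pos.trans hv
      have hdiff := signedPoly_one_sub (k := k) (m := m) (ε := ε) (x := q / v) (v := v)
      rw [div_mul_cancel₀ q hv0.ne'] at hdiff
      have hnonneg : 0 ≤ (q - ε) * (1 - q / v) * (v - ε) := by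
        have hε := h.le_one
        exact mul_nonneg (mul_nonneg (by linarith) (sub_nonneg.2 (div_mem_Icc hv0 hqv).2))
          (by linarith [le_abs_self q])
      linarith
  · intro hq
    have hr : 0 < max c |q| := h.pos.trans_le (le_max_left _ _)
    have hcont : ContinuousAt (fun v => signedPoly k m ε (q / v) v) (max c |q|) := by
      unfold signedPoly
      fun_prop (disch := exact hr.ne')
    have hnear : ∀ᶠ v in 𝓝[>] (max c |q|), 0 < signedPoly k m ε (q / v) v :=
      nhdsWithin_le_nhds (hcont.eventually_const_lt (h.rim_pos hq))
    obtain ⟨v, hG, hv⟩ := (hnear.and eventually_mem_nhdsWithin).exists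
    exact ⟨v, (le_max_left _ _).trans_lt hv, (le_max_right _ _).trans (mem_Ioi.1 hv).le, hG⟩

lemma isLowerSet_pos_of_signedPoly_one_pos (h : IsBranch k m ε c) :
    IsLowerSet {q : ℝ | 0 < q → 0 < signedPoly k m ε 1 q} := by
  intro q r hrq hq hr
  have hG := hq (hr.trans_le hrq)
  have hm := h.const_pos
  rw [signedPoly_one_left h.sq_eq_one] at hG ⊢
  rcases le_or_gt 1 k with hk | hk
  · linarith [mul_nonneg (sub_nonneg.2 hk) (sq_nonneg r)]
  · linarith [mul_le_mul_of_nonpos_left (pow_le_pow_left₀ hr.le hrq 2) (sub_nonpos.2 hk.le)]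

end IsBranch

lemma isPreconnected_preimage_val {X : Type*} [TopologicalSpace X] {s t : Set X}
    (hs : IsPreconnected s) (hst : s ⊆ t) : IsPreconnected ((↑) ⁻¹' s : Set t) := by
  rwa [← IsInducing.subtypeVal.isPreconnected_image, Subtype.image_preimage_coe,
    inter_eq_right.2 hst]

lemma bijective_connectedComponentsLift {X Y : Type*} [TopologicalSpace X] [TopologicalSpace Y]
    [TotallyDisconnectedSpace Y] {f : X → Y} (hf : Continuous f) (hsurj : Function.Surjective f)
    (hfiber : ∀ y, IsPreconnected (f ⁻¹' {y})) :
    Function.Bijective hf.connectedComponentsLift := by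
  constructor
  · intro a b hab
    obtain ⟨p, rfl⟩ := ConnectedComponents.surjective_coe a
    obtain ⟨q, rfl⟩ := ConnectedComponents.surjective_coe b
    simp only [Continuous.connectedComponentsLift_apply_coe] at hab
    exact ConnectedComponents.coe_eq_coe'.2
      ((hfiber (f q)).subset_connectedComponent rfl hab)
  · intro y
    obtain ⟨p, rfl⟩ := hsurj y
    exact ⟨p, hf.connectedComponentsLift_apply_coe p⟩

lemma natCard_connectedComponents_of_sign {X : Type*} [TopologicalSpace X] {f : X → ℝ}
    (hf : Continuous f) (hf₀ : ∀ p, f p ≠ 0) (hpos : IsConnected {p | 0 < f p})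
    (hneg : IsConnected {p | f p < 0}) : Nat.card (ConnectedComponents X) = 2 := by
  have hposEq : (fun p => decide (0 < f p)) ⁻¹' {true} = {p | 0 < f p} := by ext; simp
  have hnegEq : (fun p => decide (0 < f p)) ⁻¹' {false} = {p | f p < 0} := by
    ext p
    simpa using (hf₀ p).le_iff_lt
  have hcont : Continuous fun p => decide (0 < f p) := by
    refine (continuous_bool_rng true).2 ⟨?_, ?_⟩
    · rw [← compl_compl (_ ⁻¹' _), ← preimage_compl, Bool.compl_singleton, Bool.not_true, hnegEq]
      exact (isOpen_lt hf continuous_const).isClosed_compl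
    · rw [hposEq]
      exact isOpen_lt continuous_const hf
  have hfiber : ∀ b, IsConnected ((fun p => decide (0 < f p)) ⁻¹' {b}) :=
    Bool.forall_bool.2 ⟨hnegEq ▸ hneg, hposEq ▸ hpos⟩
  have hbij := bijective_connectedComponentsLift hcont (fun b => (hfiber b).nonempty)
    fun b => (hfiber b).isPreconnected
  rw [Nat.card_eq_of_bijective _ hbij, Nat.card_eq_fintype_card, Fintype.card_bool]

lemma separatesInTwo_of_sign {R : Set (ℝ × ℝ)} {f : ℝ × ℝ → ℝ} (hf : Continuous f)
    (hpos : IsConnected {p ∈ R | f p ∈ Ioi 0}) (hneg : IsConnected {p ∈ R | f p ∈ Iio 0}) :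
    SeparatesInTwo {p ∈ R | f p = 0} R := by
  have hne : ∀ p : ↥(R \ {p ∈ R | f p = 0}), f p ≠ 0 := fun p hp => p.2.2 ⟨p.2.1, hp⟩
  have hconn : ∀ S : Set ℝ, 0 ∉ S → IsConnected {p ∈ R | f p ∈ S} →
      IsConnected {p : ↥(R \ {p ∈ R | f p = 0}) | f p ∈ S} := by
    intro S hS hRS
    have hsub : {p ∈ R | f p ∈ S} ⊆ R \ {p ∈ R | f p = 0} :=
      fun p hp => ⟨hp.1, fun h => hS (h.2 ▸ hp.2)⟩
    have heq : {p : ↥(R \ {p ∈ R | f p = 0}) | f p ∈ S} = (↑) ⁻¹' {p ∈ R | f p ∈ S} := by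
      ext p
      exact ⟨fun hp => ⟨p.2.1, hp⟩, fun hp => hp.2⟩
    obtain ⟨p, hp⟩ := hRS.nonempty
    exact ⟨⟨⟨p, hsub hp⟩, hp.2⟩, heq ▸ isPreconnected_preimage_val hRS.isPreconnected hsub⟩
  exact ⟨fun p hp => hp.1, natCard_connectedComponents_of_sign (hf.comp continuous_subtype_val) hne
    (hconn (Ioi 0) self_notMem_Ioi hpos) (hconn (Iio 0) self_notMem_Iio hneg)⟩

namespace IsBranch

lemma isConnected_pos (h : IsBranch k m ε c) (hμ : μ ≠ 0) :
    IsConnected {p ∈ branchRegion c μ | signedPoly k m ε p.1 (μ * p.2) ∈ Ioi 0} := by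
  refine ⟨?_, isPreconnected_branchRegion_inter h.pos hμ isOpen_Ioi (fun q => h.ordConnected_pos)
    ?_⟩
  · obtain ⟨v, hv, hq, hG⟩ := h.exists_signedPoly_pos_iff.2 fun h0 => absurd h0 (lt_irrefl 0)
    refine ⟨(0 / v, v / μ), ⟨⟨div_mem_Icc (h.pos.trans hv) hq, ?_⟩, ?_⟩⟩
    · rwa [mul_div_cancel₀ _ hμ]
    · rwa [mul_div_cancel₀ _ hμ]
  · simp only [mem_Ioi, h.exists_signedPoly_pos_iff]
    exact h.isLowerSet_pos_of_signedPoly_one_pos.ordConnected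

lemma isConnected_neg (h : IsBranch k m ε c) (hμ : μ ≠ 0) :
    IsConnected {p ∈ branchRegion c μ | signedPoly k m ε p.1 (μ * p.2) ∈ Iio 0} := by
  refine ⟨?_, isPreconnected_branchRegion_inter h.pos hμ isOpen_Iio (fun q => h.ordConnected_neg)
    ?_⟩
  · obtain ⟨v, hv, hq, hG⟩ := h.exists_signedPoly_neg_iff.2 (lt_add_one ε)
    refine ⟨((ε + 1) / v, v / μ), ⟨⟨div_mem_Icc (h.pos.trans hv) hq, ?_⟩, ?_⟩⟩
    · rwa [mul_div_cancel₀ _ hμ]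
    · rwa [mul_div_cancel₀ _ hμ]
  · simp only [mem_Iio, h.exists_signedPoly_neg_iff]
    exact ordConnected_Ioi

theorem separatesInTwo (h : IsBranch k m ε c) (hμ : μ ≠ 0) :
    SeparatesInTwo (branchZeros k m ε c μ) (branchRegion c μ) :=
  separatesInTwo_of_sign (f := fun p => signedPoly k m ε p.1 (μ * p.2))
    (by unfold signedPoly; fun_prop) (h.isConnected_pos hμ) (h.isConnected_neg hμ)

end IsBranch

/-! ### Sign of `H` on the strip -/

namespace Admissible

lemma l_pos (h : Admissible ν l) : 0 < l :=
  (mul_pos two_pos (Real.sqrt_pos.2 h.1)).trans_le h.2.2.1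

lemma four_mul_le_sq (h : Admissible ν l) : 4 * ν ≤ l ^ 2 := by
  have hsq := pow_le_pow_left₀ (mul_nonneg two_pos.le ν.sqrt_nonneg) h.2.2.1 2
  rw [mul_pow, Real.sq_sqrt h.1.le] at hsq
  linarith

lemma two_mul_le (h : Admissible ν l) : 2 * ν ≤ l := by
  have hν := mul_le_mul_of_nonneg_left h.2.1.le h.1.le
  exact le_of_sq_le_sq (by linarith [h.four_mul_le_sq]) h.l_pos.le

lemma exists_roots (h : Admissible ν l) :
    ∃ a b : ℝ, 0 < b ∧ b ≤ a ∧ a < 1 ∧ ν = a * b ∧ l = a + b ∧ ν * yc ν l = -a := by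
  have hν := h.1
  have hl := h.l_pos
  have hdiscrim : 0 ≤ l ^ 2 - 4 * ν := sub_nonneg.2 h.four_mul_le_sq
  have hroot : √(l ^ 2 - 4 * ν) < l := (Real.sqrt_lt' hl).2 (by linarith)
  have hroot' : √(l ^ 2 - 4 * ν) < 2 - l :=
    (Real.sqrt_lt' (by linarith [h.2.1, h.2.2.2])).2 (by linarith [h.2.2.2])
  have hroot₀ := Real.sqrt_nonneg (l ^ 2 - 4 * ν)
  refine ⟨(l + √(l ^ 2 - 4 * ν)) / 2, (l - √(l ^ 2 - 4 * ν)) / 2, by linarith, by linarith,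
    by linarith, by linarith [Real.sq_sqrt hdiscrim], by ring, ?_⟩
  unfold yc
  field_simp

end Admissible

lemma H_eq : H ν l x y = ν * (1 - l ^ 2 - ν ^ 2) * (x * y) ^ 2 + (1 + l ^ 2 - ν ^ 2)
    + 2 * l * (1 - ν * (x * y)) * (x + ν * y) := by
  unfold H
  ring

-- On a level set of `x * y` only the factor `x + ν * y` of `H_eq` varies, so moving along the level
-- set to an edge of the region changes `H` by an explicit product.
lemma H_sub_H_neg_one : H ν l x y - H ν l (-1) (-(x * y)) =
    2 * l * (1 - ν * (x * y)) * ((1 + x) * (1 + ν * y)) := by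
  rw [H_eq, H_eq]
  ring

lemma H_sub_H_top : H ν l x y - H ν l (x * y) 1 =
    2 * l * (1 - ν * (x * y)) * ((y - 1) * (ν - x)) := by
  rw [H_eq, H_eq]
  ring

lemma H_sub_H_bottom : H ν l x y - H ν l (-(x * y)) (-1) =
    2 * l * (1 - ν * (x * y)) * ((-1 - y) * (-(x + ν))) := by
  rw [H_eq, H_eq]
  ring

lemma Admissible.H_neg_one_pos (h : Admissible ν l) (hy : 1 ≤ y ^ 2) : 0 < H ν l (-1) y := by
  have hl := h.l_pos
  obtain ⟨hν, hν1, -, hlν⟩ := h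
  have hH : H ν l (-1) y =
      ν * ((1 - (l - ν)) * (1 + (l - ν))) * (y ^ 2 - 1) + (1 - ν) * (1 + ν - l) ^ 2 := by
    unfold H
    ring
  rw [hH]
  exact add_pos_of_nonneg_of_pos
    (mul_nonneg (mul_nonneg hν.le (mul_nonneg (by linarith) (by linarith))) (sub_nonneg.2 hy))
    (mul_pos (sub_pos.2 hν1) (pow_pos (sub_pos.2 hlν) 2))

lemma Admissible.H_bottom_pos (h : Admissible ν l) (hx : x ∈ Icc (-1) 0) : 0 < H ν l x (-1) := by
  have hl := h.l_pos
  have hsq := h.four_mul_le_sq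
  have h2ν := h.two_mul_le
  obtain ⟨hν, hν1, -, hlν⟩ := h
  have hH : H ν l x (-1) = (1 + x) * (ν * (1 - l ^ 2 - ν ^ 2 + 2 * l) * (1 + x)
      + 2 * (l * (1 - ν ^ 2) - ν * (1 - l ^ 2 - ν ^ 2 + 2 * l))) + (1 - ν) * (1 + ν - l) ^ 2 := by
    unfold H
    ring
  have hgap : 0 ≤ l * (2 - l) := mul_nonneg hl.le (by linarith)
  have hlead : 0 ≤ ν * (1 - l ^ 2 - ν ^ 2 + 2 * l) :=
    mul_nonneg hν.le (by linarith [pow_lt_one₀ hν.le hν1 two_ne_zero, hgap])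
  have hlin : ν * (1 - l ^ 2 - ν ^ 2 + 2 * l) ≤ l * (1 - ν ^ 2) := by nlinarith [h2ν, hsq]
  rw [hH]
  exact add_pos_of_nonneg_of_pos
    (mul_nonneg (by linarith [hx.1]) (add_nonneg (mul_nonneg hlead (by linarith [hx.1]))
      (by linarith)))
    (mul_pos (sub_pos.2 hν1) (pow_pos (sub_pos.2 hlν) 2))

lemma Admissible.H_top_pos (h : Admissible ν l) (hx : x ∈ Icc (-1) 0) : 0 < H ν l x 1 := by
  have hl := h.l_pos
  have h2ν := h.two_mul_le
  obtain ⟨hν, hν1, -, hlν⟩ := h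
  have hν2 : 0 < 1 - ν ^ 2 := sub_pos.2 (pow_lt_one₀ hν.le hν1 two_ne_zero)
  have hH : H ν l x 1 = (1 + x) * (l * (1 - ν ^ 2) * (1 + x) + (1 - x) * (l * (1 - ν ^ 2)
      - ν * (1 - l ^ 2 - ν ^ 2 - 2 * l))) + (1 - ν) * (1 + ν - l) ^ 2 := by
    unfold H
    ring
  have hcoeff : 0 ≤ l * (1 - ν ^ 2) - ν * (1 - l ^ 2 - ν ^ 2 - 2 * l) := by
    nlinarith [mul_pos hν hl, mul_pos (mul_pos hν hl) hl, mul_le_mul_of_nonneg_right h2ν hν2.le]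
  rw [hH]
  refine add_pos_of_nonneg_of_pos (mul_nonneg (by linarith [hx.1]) (add_nonneg ?_ ?_))
    (mul_pos (sub_pos.2 hν1) (pow_pos (sub_pos.2 hlν) 2))
  · exact mul_nonneg (mul_pos hl hν2).le (by linarith [hx.1])
  · exact mul_nonneg (by linarith [hx.2]) hcoeff

-- With `ν = a * b` and `l = a + b`, the horizon `y = yc ν l` is `1 + b * y = 0`.
lemma H_eq_horizon : H (a * b) (a + b) x y =
    (1 - a ^ 2) * (a * b * (1 + b ^ 2) * (x * y) ^ 2 - 2 * (a + b) * b * (x * y) + (1 + b ^ 2))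
      + 2 * (a + b) * (1 - a * b * (x * y)) * ((x + a) * (1 + b * y)) := by
  unfold H
  ring

lemma horizon_quadratic_pos (hb : 0 < b) (hba : b ≤ a) (ha : a < 1) :
    0 < a * b * (1 + b ^ 2) * t ^ 2 - 2 * (a + b) * b * t + (1 + b ^ 2) := by
  have ha0 : 0 < a := hb.trans_le hba
  have hb3 : b ^ 3 < a := (pow_lt_self_of_lt_one₀ hb (hba.trans_lt ha) (by norm_num)).trans_le hba
  have hab : a * b < 1 := mul_lt_one_of_nonneg_of_lt_one_left ha0.le ha (hba.trans ha.le)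
  have hlead : 0 < a * b * (1 + b ^ 2) := by positivity
  have hsquare : a * b * (1 + b ^ 2) *
      (a * b * (1 + b ^ 2) * t ^ 2 - 2 * (a + b) * b * t + (1 + b ^ 2)) =
      (a * b * (1 + b ^ 2) * t - (a + b) * b) ^ 2 + b * ((1 - a * b) * (a - b ^ 3)) := by
    ring
  rw [← mul_pos_iff_of_pos_left hlead, hsquare]
  exact add_pos_of_nonneg_of_pos (sq_nonneg _)
    (mul_pos hb (mul_pos (sub_pos.2 hab) (sub_pos.2 hb3)))

namespace Admissible

lemma mul_mul_lt_one_of_nonpos (h : Admissible ν l) (hx : x ∈ Icc (-1) 1) (hy : y ≤ -1)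
    (hH : H ν l x y ≤ 0) : ν * (x * y) < 1 := by
  by_contra! hxy
  have hνy : 1 + ν * y ≤ 0 := by
    have hgap : 0 ≤ (1 + x) * -y := mul_nonneg (by linarith [hx.1]) (by linarith)
    linarith [mul_nonneg h.1.le hgap]
  have hxy_one : 1 ≤ x * y := by
    by_contra! hlt
    linarith [mul_lt_mul_of_pos_left hlt h.1, h.2.1]
  have hpos := h.H_neg_one_pos (y := -(x * y)) (by rw [neg_sq]; exact one_le_pow₀ hxy_one)
  have hdiff : 0 ≤ 2 * l * (1 - ν * (x * y)) * ((1 + x) * (1 + ν * y)) :=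
    mul_nonneg_of_nonpos_of_nonpos
      (mul_nonpos_of_nonneg_of_nonpos (by linarith [h.l_pos]) (by linarith))
      (mul_nonpos_of_nonneg_of_nonpos (by linarith [hx.1]) hνy)
  rw [← H_sub_H_neg_one] at hdiff
  linarith

lemma lt_yc_of_nonpos (h : Admissible ν l) (hx : x ∈ Icc (-1) 1) (hy : y ≤ -1)
    (hH : H ν l x y ≤ 0) : y < yc ν l ∧ ν * yc ν l < x := by
  have hxy := h.mul_mul_lt_one_of_nonpos hx hy hH
  obtain ⟨a, b, hb, hba, ha, rfl, rfl, hyc⟩ := h.exists_roots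
  have ha0 : 0 < a := hb.trans_le hba
  have hbyc : b * yc (a * b) (a + b) = -1 :=
    mul_left_cancel₀ ha0.ne' (by linear_combination hyc)
  have hfactor : 0 < 2 * (a + b) * (1 - a * b * (x * y)) :=
    mul_pos (by linarith) (sub_pos.2 hxy)
  have hhorizon : (x + a) * (1 + b * y) < 0 := by
    rw [H_eq_horizon] at hH
    have hquad := mul_pos (sub_pos.2 (pow_lt_one₀ ha0.le ha two_ne_zero))
      (horizon_quadratic_pos (t := x * y) hb hba ha)
    exact (pos_iff_neg_of_mul_neg (by linarith)).1 hfactor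
  rcases mul_neg_iff.1 hhorizon with ⟨hxa, hby⟩ | ⟨hxa, hby⟩
  · exact ⟨lt_of_mul_lt_mul_left (by linarith) hb.le, by linarith⟩
  exfalso
  have hba1 : a * b < a := mul_lt_of_lt_one_right ha0 (hba.trans_lt ha)
  rcases le_total (x * y) 1 with hle | hge
  · have hxy₀ : 0 ≤ x * y := mul_nonneg_of_nonpos_of_nonpos (by linarith) (by linarith)
    have hpos := h.H_bottom_pos (x := -(x * y)) ⟨by linarith, by linarith⟩
    have hdiff := mul_nonneg hfactor.le
      (mul_nonneg (by linarith : 0 ≤ -1 - y) (by linarith : 0 ≤ -(x + a * b)))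
    rw [← H_sub_H_bottom] at hdiff
    linarith
  · have hpos := h.H_neg_one_pos (y := -(x * y)) (by rw [neg_sq]; exact one_le_pow₀ hge)
    have haby := mul_nonneg (sub_pos.2 ha).le (mul_nonneg hb.le (by linarith : 0 ≤ -y))
    have hdiff := mul_nonneg hfactor.le
      (mul_nonneg (by linarith [hx.1] : 0 ≤ 1 + x) (by linarith : 0 ≤ 1 + a * b * y))
    rw [← H_sub_H_neg_one] at hdiff
    linarith

lemma H_pos_of_fst_nonpos (h : Admissible ν l) (hx : x ∈ Icc (-1) 0) (hy : 1 ≤ y) :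
    0 < H ν l x y := by
  have hxy : x * y ≤ 0 := mul_nonpos_of_nonpos_of_nonneg hx.2 (by linarith)
  have hfactor : 0 ≤ 2 * l * (1 - ν * (x * y)) :=
    mul_nonneg (by linarith [h.l_pos])
      (by linarith [mul_nonpos_of_nonneg_of_nonpos h.1.le hxy])
  rcases le_total (-1) (x * y) with hge | hle
  · have hdiff := mul_nonneg hfactor
      (mul_nonneg (sub_nonneg.2 hy) (by linarith [hx.2, h.1] : 0 ≤ ν - x))
    rw [← H_sub_H_top] at hdiff
    linarith [h.H_top_pos ⟨hge, hxy⟩]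
  · have hdiff := mul_nonneg hfactor (mul_nonneg (by linarith [hx.1] : 0 ≤ 1 + x)
      (by linarith [mul_pos h.1 (one_pos.trans_le hy)] : 0 ≤ 1 + ν * y))
    rw [← H_sub_H_neg_one] at hdiff
    linarith [h.H_neg_one_pos (y := -(x * y)) (one_le_pow₀ (by linarith))]

lemma const_coeff_pos (h : Admissible ν l) : 0 < 1 + l ^ 2 - ν ^ 2 := by
  linarith [pow_lt_one₀ h.1.le h.2.1 two_ne_zero, pow_pos h.l_pos 2]

lemma sum_coeff_pos (h : Admissible ν l) :
    0 < (1 - l ^ 2 - ν ^ 2) + ν * (1 + l ^ 2 - ν ^ 2) := by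
  have hfactors : 0 < (1 - ν) * ((1 + ν - l) * (1 + ν + l)) :=
    mul_pos (sub_pos.2 h.2.1) (mul_pos (sub_pos.2 h.2.2.2) (by linarith [h.1, h.l_pos]))
  linarith

lemma one_lt_mul_mul_of_nonpos (h : Admissible ν l) (hx : x ∈ Icc (-1) 1) (hy : 1 ≤ y)
    (hH : H ν l x y ≤ 0) : 1 < ν * (x * y) := by
  have hx0 : 0 < x := by
    by_contra! hx0
    exact (h.H_pos_of_fst_nonpos ⟨hx.1, hx0⟩ hy).not_ge hH
  by_contra! hP
  have hP0 : 0 < ν * (x * y) := mul_pos h.1 (mul_pos hx0 (one_pos.trans_le hy))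
  have hconst : 0 < ν * (1 - l ^ 2 - ν ^ 2) * (x * y) ^ 2 + (1 + l ^ 2 - ν ^ 2) := by
    refine (mul_pos_iff_of_pos_left h.1).1 ?_
    have hfirst := mul_pos h.sum_coeff_pos (pow_pos hP0 2)
    have hsecond := mul_nonneg (mul_pos h.1 h.const_coeff_pos).le
      (sub_nonneg.2 (pow_le_one₀ hP0.le hP (n := 2)))
    linarith
  have hlast : 0 ≤ 2 * l * (1 - ν * (x * y)) * (x + ν * y) :=
    mul_nonneg (mul_nonneg (by linarith [h.l_pos]) (sub_nonneg.2 hP))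
      (add_pos hx0 (mul_pos h.1 (one_pos.trans_le hy))).le
  rw [H_eq] at hH
  linarith

lemma yc_lt_neg_one (h : Admissible ν l) : yc ν l < -1 := by
  obtain ⟨a, b, hb, hba, ha, rfl, -, hyc⟩ := h.exists_roots
  have hab : a * b < a := mul_lt_of_lt_one_right (hb.trans_le hba) (hba.trans_lt ha)
  exact lt_of_mul_lt_mul_left (by linarith : a * b * _ < a * b * -1) h.1.le

end Admissible

/-- The constant coefficient of `H` in the normal form `signedPoly`; the leading coefficient there
is `(xStar ν l)⁻¹`. -/
noncomputable def constCoeff (ν l : ℝ) : ℝ := (1 + l ^ 2 - ν ^ 2) / (2 * l)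

lemma H_eq_signedPoly (hl : l ≠ 0) (hε : ε = 1 ∨ ε = -1) (hμ : μ = ε * ν) :
    H ν l x y = 2 * l * signedPoly (xStar ν l)⁻¹ (constCoeff ν l) ε x (μ * y) := by
  rw [H_eq, hμ, signedPoly, xStar, constCoeff, inv_div]
  rcases hε with rfl | rfl <;> field_simp <;> ring

namespace Admissible

lemma inv_xStar_sub_one (h : Admissible ν l) :
    (xStar ν l)⁻¹ - 1 = (1 - (l + ν)) * (1 + l + ν) / (2 * l * ν) := by
  have hν := h.1.ne'
  have hl := h.l_pos.ne'
  rw [xStar, inv_div]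
  field_simp
  ring

lemma one_lt_inv_xStar (h : Admissible ν l) (hlν : l + ν < 1) : 1 < (xStar ν l)⁻¹ := by
  have hν := h.1
  have hl := h.l_pos
  rw [← sub_pos, h.inv_xStar_sub_one]
  exact div_pos (mul_pos (sub_pos.2 hlν) (by positivity)) (by positivity)

lemma inv_xStar_lt_one (h : Admissible ν l) (hlν : 1 < l + ν) : (xStar ν l)⁻¹ < 1 := by
  have hν := h.1
  have hl := h.l_pos
  rw [← sub_neg, h.inv_xStar_sub_one]
  exact div_neg_of_neg_of_pos (mul_neg_of_neg_of_pos (sub_neg.2 hlν) (by positivity))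
    (by positivity)

lemma inv_xStar_eq_one (h : Admissible ν l) (hlν : l + ν = 1) : (xStar ν l)⁻¹ = 1 := by
  rw [← sub_eq_zero, h.inv_xStar_sub_one, hlν, sub_self, zero_mul, zero_div]

lemma constCoeff_pos (h : Admissible ν l) : 0 < constCoeff ν l :=
  div_pos h.const_coeff_pos (mul_pos two_pos h.l_pos)

lemma inv_xStar_add_constCoeff_pos (h : Admissible ν l) : 0 < (xStar ν l)⁻¹ + constCoeff ν l := by
  have hν := h.1
  have hl := h.l_pos
  have hsum : (xStar ν l)⁻¹ + constCoeff ν l =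
      ((1 - l ^ 2 - ν ^ 2) + ν * (1 + l ^ 2 - ν ^ 2)) / (2 * l * ν) := by
    rw [xStar, constCoeff, inv_div]
    field_simp
    ring
  rw [hsum]
  exact div_pos h.sum_coeff_pos (by positivity)

lemma signedPoly_nonpos_iff (h : Admissible ν l) (hε : ε = 1 ∨ ε = -1) (hμ : μ = ε * ν) :
    signedPoly (xStar ν l)⁻¹ (constCoeff ν l) ε x (μ * y) ≤ 0 ↔ H ν l x y ≤ 0 := by
  rw [H_eq_signedPoly h.l_pos.ne' hε hμ, ← neg_nonneg, ← neg_nonneg (a := _ * _),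
    ← mul_neg, mul_nonneg_iff_of_pos_left (mul_pos two_pos h.l_pos)]

lemma sing_inter_branchRegion (h : Admissible ν l) (hε : ε = 1 ∨ ε = -1) (hμ : μ = ε * ν) :
    Sing ν l ∩ branchRegion c μ = branchZeros (xStar ν l)⁻¹ (constCoeff ν l) ε c μ := by
  ext ⟨x, y⟩
  simp only [Sing, branchZeros, branchRegion, mem_inter_iff, mem_ofPred_eq,
    H_eq_signedPoly h.l_pos.ne' hε hμ, mul_eq_zero, (mul_pos two_pos h.l_pos).ne',
    false_or]
  tauto

lemma isBranch_lower (h : Admissible ν l) :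
    IsBranch (xStar ν l)⁻¹ (constCoeff ν l) (-1) (-(ν * yc ν l)) where
  sign := .inr rfl
  pos := neg_pos.2 (mul_neg_of_pos_of_neg h.1 (h.yc_lt_neg_one.trans neg_one_lt_zero))
  lt_one := by
    obtain ⟨a, b, -, -, ha, -, -, hyc⟩ := h.exists_roots
    rwa [hyc, neg_neg]
  const_pos := h.constCoeff_pos
  sum_pos := h.inv_xStar_add_constCoeff_pos
  of_nonpos x hx v hv hG := by
    obtain ⟨y, rfl⟩ : ∃ y, v = -ν * y := ⟨v / -ν, (mul_div_cancel₀ v (neg_ne_zero.2 h.1.ne')).symm⟩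
    rw [h.signedPoly_nonpos_iff (.inr rfl) (neg_one_mul ν).symm] at hG
    have hy : y ≤ yc ν l := le_of_mul_le_mul_left (by linarith) h.1
    have hloc := h.lt_yc_of_nonpos hx (hy.trans h.yc_lt_neg_one.le) hG
    have hxy := h.mul_mul_lt_one_of_nonpos hx (hy.trans h.yc_lt_neg_one.le) hG
    exact ⟨by linarith [mul_lt_mul_of_pos_left hloc.1 h.1], by linarith [hloc.2], by linarith⟩

lemma isBranch_upper (h : Admissible ν l) : IsBranch (xStar ν l)⁻¹ (constCoeff ν l) 1 ν where
  sign := .inl rfl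
  pos := h.1
  lt_one := h.2.1
  const_pos := h.constCoeff_pos
  sum_pos := h.inv_xStar_add_constCoeff_pos
  of_nonpos x hx v hv hG := by
    obtain ⟨y, rfl⟩ : ∃ y, v = ν * y := ⟨v / ν, (mul_div_cancel₀ v h.1.ne').symm⟩
    rw [h.signedPoly_nonpos_iff (.inl rfl) (one_mul ν).symm] at hG
    have hxy := h.one_lt_mul_mul_of_nonpos hx (le_of_mul_le_mul_left (by linarith) h.1) hG
    have hνy : 0 < ν * y := h.1.trans_le hv
    have hprod : 1 < x * (ν * y) := by linarith
    have hx0 : 0 < x := pos_of_mul_pos_left (one_pos.trans hprod) hνy.le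
    exact ⟨by linarith [mul_le_of_le_one_left hνy.le hx.2, h.2.1], by linarith [h.1], hprod⟩

lemma sing_inter_outside (h : Admissible ν l) : Sing ν l ∩ {p | p.2 ∉ Ioo (-1) 1} =
    (Sing ν l ∩ upperRegion) ∪ (Sing ν l ∩ lowerRegion ν l) := by
  ext ⟨x, y⟩
  simp only [upperRegion, lowerRegion, mem_union, mem_inter_iff, mem_prod, mem_ofPred_eq, mem_Ioo,
    mem_Iio, mem_Ioi, not_and_or, not_lt]
  constructor
  · rintro ⟨⟨hx, hH⟩, hy | hy⟩
    · exact .inr ⟨⟨hx, hH⟩, hx, (h.lt_yc_of_nonpos hx hy hH.le).1⟩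
    · refine .inl ⟨⟨hx, hH⟩, hx, hy.lt_of_ne' ?_⟩
      rintro rfl
      linarith [h.one_lt_mul_mul_of_nonpos hx le_rfl hH.le, h.2.1,
        mul_le_mul_of_nonneg_left hx.2 h.1.le]
  · rintro (⟨hp, -, hy⟩ | ⟨hp, -, hy⟩)
    · exact ⟨hp, .inr hy.le⟩
    · exact ⟨hp, .inl (hy.trans h.yc_lt_neg_one).le⟩

end Admissible

lemma lowerRegion_eq_branchRegion (hν : 0 < ν) :
    lowerRegion ν l = branchRegion (-(ν * yc ν l)) (-ν) := by
  ext ⟨x, y⟩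
  simp only [lowerRegion, branchRegion, mem_prod, mem_Iio, mem_ofPred_eq, neg_mul, neg_lt_neg_iff,
    mul_lt_mul_iff_right₀ hν]

lemma upperRegion_eq_branchRegion (hν : 0 < ν) : upperRegion = branchRegion ν ν := by
  ext ⟨x, y⟩
  simp only [upperRegion, branchRegion, mem_prod, mem_Ioi, mem_ofPred_eq,
    lt_mul_iff_one_lt_right hν]

end PomeranskySenkov

open PomeranskySenkov in
theorem mainTheorem3 (ν l : ℝ) (h : Admissible ν l) :
    ∃ γm γp : Set (ℝ × ℝ),
      Sing ν l ∩ {p | p.2 ∉ Ioo (-1) 1} = γp ∪ γm ∧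
      IsConnectedCurve γm ∧ IsConnectedCurve γp ∧
      SeparatesInTwo γm (lowerRegion ν l) ∧ SeparatesInTwo γp upperRegion ∧
      (l + ν < 1 →
        (StaysAwayFrom γm (-1) ∧ StaysAwayFrom γm 1 ∧
          AsymptotesToTwoLines γm 0 (xStar ν l) atBot) ∧
        (StaysAwayFrom γp (-1) ∧ StaysAwayFrom γp 1 ∧
          AsymptotesToTwoLines γp 0 (xStar ν l) atTop)) ∧
      (1 < l + ν →
        ((∃! p, p ∈ γm ∧ p.1 = 1) ∧ StaysAwayFrom γm (-1) ∧ AsymptotesToOneLine γm 0 atBot) ∧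
        ((∃! p, p ∈ γp ∧ p.1 = 1) ∧ StaysAwayFrom γp (-1) ∧ AsymptotesToOneLine γp 0 atTop)) ∧
      (l + ν = 1 →
        (StaysAwayFrom γm (-1) ∧ AsymptotesToTwoLines γm 0 1 atBot ∧ ∀ p ∈ γm, p.1 ≠ 1) ∧
        (StaysAwayFrom γp (-1) ∧ AsymptotesToTwoLines γp 0 1 atTop ∧ ∀ p ∈ γp, p.1 ≠ 1)) := by
  have hp := h.1.ne'
  have hm := neg_ne_zero.2 hp
  have hbot : Tendsto (· / -ν) atTop atBot := tendsto_id.atTop_div_const_of_neg (neg_neg_of_pos h.1)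
  have htop : Tendsto (· / ν) atTop atTop := tendsto_id.atTop_div_const h.1
  have hlow := h.isBranch_lower
  have hup := h.isBranch_upper
  refine ⟨Sing ν l ∩ lowerRegion ν l, Sing ν l ∩ upperRegion, h.sing_inter_outside, ?_⟩
  rw [lowerRegion_eq_branchRegion h.1, upperRegion_eq_branchRegion h.1,
    h.sing_inter_branchRegion (.inr rfl) (neg_one_mul ν).symm,
    h.sing_inter_branchRegion (.inl rfl) (one_mul ν).symm]
  refine ⟨hlow.isConnectedCurve hm, hup.isConnectedCurve hp, hlow.separatesInTwo hm,
    hup.separatesInTwo hp, fun hlt => ?_, fun hgt => ?_, fun heq => ?_⟩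
  · have hk := h.one_lt_inv_xStar hlt
    exact ⟨⟨hlow.staysAwayFrom_neg_one, hlow.staysAwayFrom_one hk,
      by simpa only [inv_inv] using hlow.asymptotesToTwoLines hm hk.le hbot⟩,
      hup.staysAwayFrom_neg_one, hup.staysAwayFrom_one hk,
      by simpa only [inv_inv] using hup.asymptotesToTwoLines hp hk.le htop⟩
  · have hk := h.inv_xStar_lt_one hgt
    exact ⟨⟨hlow.existsUnique_fst_eq_one hm hk, hlow.staysAwayFrom_neg_one,
      hlow.asymptotesToOneLine hm hk hbot⟩, hup.existsUnique_fst_eq_one hp hk,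
      hup.staysAwayFrom_neg_one, hup.asymptotesToOneLine hp hk htop⟩
  · have hk := h.inv_xStar_eq_one heq
    have hx : (xStar ν l)⁻¹⁻¹ = 1 := inv_eq_one.2 hk
    exact ⟨⟨hlow.staysAwayFrom_neg_one, hx ▸ hlow.asymptotesToTwoLines hm hk.ge hbot,
      fun _ => hlow.fst_ne_one hk.ge⟩, hup.staysAwayFrom_neg_one,
      hx ▸ hup.asymptotesToTwoLines hp hk.ge htop, fun _ => hup.fst_ne_one hk.ge⟩
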